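/- All C*-algebras here are unital and separable. A separable C*-algebra $\mathcal{E}$ is called an MF algebra if it can be embedded as a C*-subalgebra (equivalently, by an injective $*$-homomorphism) into $\prod_{n}\mathcal{M}_{k_n}(\mathbb{C})/\sum_{n}\mathcal{M}_{k_n}(\mathbb{C})$ for some sequence $(k_n)_{n\ge 1}$ of positive integers, where $\prod_n \mathcal{M}_{k_n}(\mathbb{C})$ is the C*-algebra of norm-bounded sequences of matrices and $\sum_n \mathcal{M}_{k_n}(\mathbb{C})$ is the ideal of sequences whose norms tend to $0$. For unital embeddings $\mathcal{A}\supseteq\mathcal{D}\subseteq\mathcal{B}$, the unital full amalgamated free product $\mathcal{A}\ast_{\mathcal{D}}\mathcal{B}$ is the unital C*-algebra generated by copies of $\mathcal{A}$ and $\mathcal{B}$ that agree on $\mathcal{D}$ and universal for this property: any two unital $*$-homomorphisms from $\mathcal{A}$ and from $\mathcal{B}$ into a unital C*-algebra that agree on $\mathcal{D}$ extend to a common $*$-homomorphism on $\mathcal{A}\ast_{\mathcal{D}}\mathcal{B}$. Theorem. Let $\mathcal{A}\supseteq\mathcal{D}\subseteq\mathcal{B}$ be unital inclusions of unital separable C*-algebras,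 and let $\mathcal{D}_1\subseteq\mathcal{D}_2\subseteq\cdots$ be an increasing sequence of unital C*-subalgebras of $\mathcal{D}$ (each containing the unit of $\mathcal{D}$) such that $\bigcup_{k\ge 1}\mathcal{D}_k$ is norm dense in $\mathcal{D}$. If $\mathcal{A}\ast_{\mathcal{D}_k}\mathcal{B}$ is an MF algebra for every $k\ge 1$, then $\mathcal{A}\ast_{\mathcal{D}}\mathcal{B}$ is an MF algebra. -/

import Mathlib

open Filter Topology
open scoped ENNReal

noncomputable section

/-! ### C*-seminorms and the C*-algebra obtained by separation and completion -/

/-- A C*-seminorm on a complex unital *-algebra: a submultiplicative seminorm with the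
C*-identity `p (x* x) = p x ^ 2`. -/
structure CStarSeminorm (F : Type*) [Ring F] [Algebra ℂ F] [StarRing F] extends
    Seminorm ℂ F where
  mul_le' : ∀ x y, toFun (x * y) ≤ toFun x * toFun y
  star_mul_self' : ∀ x, toFun (star x * x) = toFun x ^ 2

namespace CStarSeminorm

variable {F : Type*} [Ring F] [Algebra ℂ F] [StarRing F]

instance : CoeFun (CStarSeminorm F) (fun _ => F → ℝ) := ⟨fun p => p.toFun⟩

variable (p : CStarSeminorm F)

theorem nonneg (x : F) : 0 ≤ p x := apply_nonneg p.toSeminorm x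

theorem map_zero : p 0 = 0 := _root_.map_zero p.toSeminorm

theorem add_le (x y : F) : p (x + y) ≤ p x + p y := map_add_le_add p.toSeminorm x y

theorem map_smul (c : ℂ) (x : F) : p (c • x) = ‖c‖ * p x := map_smul_eq_mul p.toSeminorm c x

theorem map_neg (x : F) : p (-x) = p x := map_neg_eq_map p.toSeminorm x

theorem mul_le (x y : F) : p (x * y) ≤ p x * p y := p.mul_le' x y

theorem star_mul_self (x : F) : p (star x * x) = p x ^ 2 := p.star_mul_self' x

theorem le_star (x : F) : p x ≤ p (star x) := by
  by_contra! h
  have h1 := p.star_mul_self x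
  have h2 := p.mul_le (star x) x
  have h3 := p.nonneg (star x)
  nlinarith

theorem map_star (x : F) : p (star x) = p x :=
  le_antisymm (by simpa using p.le_star (star x)) (p.le_star x)

/-- The *-algebra `F`, regarded as a seminormed space through the C*-seminorm `p`. -/
def Dom (_p : CStarSeminorm F) : Type _ := F

instance : Ring p.Dom := inferInstanceAs (Ring F)

instance : Algebra ℂ p.Dom := inferInstanceAs (Algebra ℂ F)

instance : StarRing p.Dom := inferInstanceAs (StarRing F)

instance [StarModule ℂ F] : StarModule ℂ p.Dom := inferInstanceAs (StarModule ℂ F)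

instance : SeminormedAddCommGroup p.Dom :=
  AddGroupSeminorm.toSeminormedAddCommGroup p.toSeminorm.toAddGroupSeminorm

theorem norm_def (x : p.Dom) : ‖x‖ = p x := rfl

instance : SeminormedRing p.Dom where
  __ : SeminormedAddCommGroup p.Dom := inferInstance
  __ : Ring p.Dom := inferInstance
  norm_mul_le := p.mul_le

instance : NormedSpace ℂ p.Dom where
  norm_smul_le c x := (p.map_smul c x).le

theorem isometry_star : Isometry (star : p.Dom → p.Dom) :=
  AddMonoidHomClass.isometry_of_norm (starAddEquiv : p.Dom ≃+ p.Dom) (fun x => p.map_star x)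

theorem norm_star_mul_self_dom (x : p.Dom) : ‖star x * x‖ = ‖x‖ * ‖x‖ :=
  (p.star_mul_self x).trans (sq _)

/-- The separation and completion of the *-algebra `F` for the C*-seminorm `p`. -/
abbrev Compl : Type _ := UniformSpace.Completion p.Dom

/-- The canonical map of the *-algebra into its completion. -/
def toCompl (x : F) : p.Compl := UniformSpace.Completion.coe' (α := p.Dom) x

theorem norm_toCompl (x : F) : ‖p.toCompl x‖ = p x :=
  UniformSpace.Completion.norm_coe (E := p.Dom) x

theorem continuous_star_compl :
    Continuous (UniformSpace.Completion.map (star : p.Dom → p.Dom)) :=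
  UniformSpace.Completion.continuous_map

instance : Star p.Compl := ⟨UniformSpace.Completion.map (star : p.Dom → p.Dom)⟩

theorem star_coe (x : p.Dom) : star (x : p.Compl) = ((star x : p.Dom) : p.Compl) :=
  UniformSpace.Completion.map_coe p.isometry_star.uniformContinuous x

instance : ContinuousStar p.Compl := ⟨p.continuous_star_compl⟩

instance : StarRing p.Compl where
  star_involutive x := by
    induction x using UniformSpace.Completion.induction_on with
    | hp => exact isClosed_eq (by fun_prop) (by fun_prop)
    | ih x => rw [star_coe, star_coe, star_star]
  star_mul x y := by
    induction x, y using UniformSpace.Completion.induction_on₂ with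
    | hp => exact isClosed_eq (by fun_prop) (by fun_prop)
    | ih x y =>
      rw [star_coe, star_coe, ← UniformSpace.Completion.coe_mul, star_coe, star_mul,
        ← UniformSpace.Completion.coe_mul]
  star_add x y := by
    induction x, y using UniformSpace.Completion.induction_on₂ with
    | hp => exact isClosed_eq (by fun_prop) (by fun_prop)
    | ih x y =>
      rw [star_coe, star_coe, ← UniformSpace.Completion.coe_add, star_coe, star_add,
        ← UniformSpace.Completion.coe_add]

instance : CStarRing p.Compl where
  norm_mul_self_le x := by
    induction x using UniformSpace.Completion.induction_on with
    | hp => exact isClosed_le (by fun_prop) (by fun_prop)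
    | ih x =>
      rw [star_coe, ← UniformSpace.Completion.coe_mul, UniformSpace.Completion.norm_coe,
        UniformSpace.Completion.norm_coe, norm_star_mul_self_dom]

instance : NormedAlgebra ℂ p.Compl where
  norm_smul_le := norm_smul_le

instance [StarModule ℂ F] : StarModule ℂ p.Compl where
  star_smul c x := by
    induction x using UniformSpace.Completion.induction_on with
    | hp =>
      have h (c : ℂ) : Continuous (fun x : p.Compl => c • x) := continuous_const_smul c
      exact isClosed_eq (continuous_star.comp (h c)) ((h (star c)).comp continuous_star)
    | ih x =>
      have h1 : c • (x : p.Compl) = ((c • x : p.Dom) : p.Compl) :=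
        (UniformSpace.Completion.coe_smul c x).symm
      have h2 : star c • ((star x : p.Dom) : p.Compl) = ((star c • star x : p.Dom) : p.Compl) :=
        (UniformSpace.Completion.coe_smul (star c) (star x)).symm
      rw [h1, star_coe, star_coe, h2, star_smul]

instance [StarModule ℂ F] : CStarAlgebra p.Compl where

/-- The canonical unital *-homomorphism of the *-algebra into its completion. -/
def toComplHom [StarModule ℂ F] : F →⋆ₐ[ℂ] p.Compl where
  toFun := p.toCompl
  map_one' := UniformSpace.Completion.coe_one p.Dom
  map_mul' x y := UniformSpace.Completion.coe_mul (α := p.Dom) x y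
  map_zero' := UniformSpace.Completion.coe_zero (α := p.Dom)
  map_add' x y := UniformSpace.Completion.coe_add (α := p.Dom) x y
  commutes' c := (UniformSpace.Completion.algebraMap_def (A := p.Dom) (R := ℂ) c).symm
  map_star' x := (p.star_coe x).symm

/-- A C*-seminorm on a C*-algebra is dominated by the norm. -/
theorem le_norm {A : Type*} [CStarAlgebra A] (p : CStarSeminorm A) (a : A) : p a ≤ ‖a‖ := by
  rw [← p.norm_toCompl]
  exact NonUnitalStarAlgHom.norm_apply_le p.toComplHom a

/-- The C*-seminorm defined by a *-homomorphism to a C*-algebra. -/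
def ofHom {E : Type*} [CStarAlgebra E] (ρ : F →⋆ₐ[ℂ] E) : CStarSeminorm F where
  toSeminorm := Seminorm.of (fun x => ‖ρ x‖)
    (fun x y => by rw [map_add]; exact norm_add_le _ _)
    (fun c x => by rw [_root_.map_smul, norm_smul])
  mul_le' x y := (congrArg norm (map_mul ρ x y)).le.trans (norm_mul_le _ _)
  star_mul_self' x := by
    change ‖ρ (star x * x)‖ = ‖ρ x‖ ^ 2
    rw [map_mul, StarHomClass.map_star, CStarRing.norm_star_mul_self, sq]

theorem ofHom_apply {E : Type*} [CStarAlgebra E] (ρ : F →⋆ₐ[ℂ] E) (x : F) :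
    ofHom ρ x = ‖ρ x‖ := rfl

/-- A *-homomorphism to a C*-algebra dominated by `p` extends to the completion. -/
theorem exists_extension [StarModule ℂ F] {E : Type*} [CStarAlgebra E] (ρ : F →⋆ₐ[ℂ] E)
    (hρ : ∀ x, ‖ρ x‖ ≤ p x) : ∃ π : p.Compl →⋆ₐ[ℂ] E, ∀ x, π (p.toComplHom x) = ρ x := by
  let r : p.Dom →+* E := (ρ : F →+* E)
  have hr : Continuous r :=
    AddMonoidHomClass.continuous_of_bound r 1 fun x => by rw [one_mul]; exact hρ x
  let R : p.Compl →+* E := UniformSpace.Completion.extensionHom r hr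
  have hRc : Continuous R := UniformSpace.Completion.continuous_extension
  have hR (x : p.Dom) : R x = r x := UniformSpace.Completion.extensionHom_coe r hr x
  refine ⟨{ R with commutes' := fun c => ?_, map_star' := fun x => ?_ }, fun x => hR x⟩
  · exact (hR (algebraMap ℂ p.Dom c)).trans (AlgHomClass.commutes ρ c)
  · change R (star x) = star (R x)
    induction x using UniformSpace.Completion.induction_on with
    | hp => exact isClosed_eq (hRc.comp continuous_star) (continuous_star.comp hRc)
    | ih x =>
      rw [star_coe, hR, hR]
      exact StarHomClass.map_star ρ x

/-- Two *-homomorphisms on the completion that agree on the *-algebra are equal. -/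
theorem hom_ext [StarModule ℂ F] {E : Type*} [CStarAlgebra E] (π π' : p.Compl →⋆ₐ[ℂ] E)
    (h : ∀ x, π (p.toComplHom x) = π' (p.toComplHom x)) : π = π' := by
  have hc (σ : p.Compl →⋆ₐ[ℂ] E) : Continuous σ :=
    AddMonoidHomClass.continuous_of_bound σ 1 fun x => by
      rw [one_mul]; exact NonUnitalStarAlgHom.norm_apply_le σ x
  refine StarAlgHom.ext fun x => ?_
  induction x using UniformSpace.Completion.induction_on with
  | hp => exact isClosed_eq (hc π) (hc π')
  | ih x => exact h x

end CStarSeminorm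

/-! ### The free *-algebra on the disjoint union of two sets with involution -/

/-- The free complex unital *-algebra on the letters `a : A` and `b : B`, in which the adjoint of
a letter is the letter `star a`, respectively `star b`: noncommutative polynomials in the letters,
that is, complex linear combinations of words. -/
abbrev FreeStarAlg (A B : Type*) : Type _ := MonoidAlgebra ℂ (FreeMonoid (A ⊕ B))

namespace FreeStarAlg

variable {A B : Type*}

/-- The letter `x` as an element of the free *-algebra. -/
def of (x : A ⊕ B) : FreeStarAlg A B := MonoidAlgebra.of ℂ (FreeMonoid (A ⊕ B)) (FreeMonoid.of x)

/-- The algebra homomorphism determined by the images of the letters. -/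
def lift {E : Type*} [Ring E] [Algebra ℂ E] (f : A ⊕ B → E) : FreeStarAlg A B →ₐ[ℂ] E :=
  MonoidAlgebra.lift ℂ E (FreeMonoid (A ⊕ B)) (FreeMonoid.lift f)

@[simp] theorem lift_of {E : Type*} [Ring E] [Algebra ℂ E] (f : A ⊕ B → E) (x : A ⊕ B) :
    lift f (of x) = f x := by
  rw [lift, of, MonoidAlgebra.lift_of, FreeMonoid.lift_eval_of]

theorem induction {P : FreeStarAlg A B → Prop} (hs : ∀ c : ℂ, P (algebraMap ℂ _ c))
    (hof : ∀ x, P (of x)) (hadd : ∀ x y, P x → P y → P (x + y))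
    (hmul : ∀ x y, P x → P y → P (x * y)) (x : FreeStarAlg A B) : P x := by
  refine MonoidAlgebra.induction_on (motive := P) x (fun w => ?_) hadd (fun c y hy => ?_)
  · induction w using FreeMonoid.inductionOn' with
    | one => exact (_root_.map_one (algebraMap ℂ (FreeStarAlg A B))) ▸ hs 1
    | of_mul x w ih =>
      have := hmul _ _ (hof x) ih
      rwa [of, ← _root_.map_mul] at this
  · have := hmul _ _ (hs c) hy
    rwa [← Algebra.smul_def] at this

variable [InvolutiveStar A] [InvolutiveStar B]

/-- The adjoint as a ring homomorphism to the opposite ring: it conjugates the coefficients, and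
reverses words and takes the adjoint of each letter. -/
def starHom : FreeStarAlg A B →+* (FreeStarAlg A B)ᵐᵒᵖ :=
  MonoidAlgebra.liftNCRingHom
    ((algebraMap ℂ (FreeStarAlg A B)ᵐᵒᵖ).comp (starRingEnd ℂ))
    (FreeMonoid.lift fun x => MulOpposite.op (of (Sum.map star star x)))
    (fun c _ => Algebra.commutes (starRingEnd ℂ c) _)

theorem starHom_of (x : A ⊕ B) :
    starHom (of x) = MulOpposite.op (of (Sum.map star star x)) := by
  rw [starHom, of, MonoidAlgebra.of_apply]
  refine (MonoidAlgebra.liftNCRingHom_single _ _ _ _ _).trans ?_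
  rw [_root_.map_one, one_mul, FreeMonoid.lift_eval_of]

theorem starHom_algebraMap (c : ℂ) :
    starHom (algebraMap ℂ (FreeStarAlg A B) c) =
      MulOpposite.op (algebraMap ℂ (FreeStarAlg A B) (star c)) := by
  have h : algebraMap ℂ (FreeStarAlg A B) c =
      MonoidAlgebra.single (1 : FreeMonoid (A ⊕ B)) c := rfl
  rw [h, starHom]
  refine (MonoidAlgebra.liftNCRingHom_single _ _ _ _ _).trans ?_
  rw [_root_.map_one, mul_one]
  rfl

instance : StarRing (FreeStarAlg A B) where
  star x := (starHom x).unop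
  star_involutive x := by
    induction x using induction with
    | hs c =>
      beta_reduce
      rw [starHom_algebraMap, MulOpposite.unop_op, starHom_algebraMap,
        MulOpposite.unop_op, star_star]
    | hof x => cases x <;> simp [starHom_of]
    | hadd x y hx hy => simp [hx, hy]
    | hmul x y hx hy => simp [hx, hy]
  star_mul x y := by simp
  star_add x y := by simp

@[simp] theorem star_of (x : A ⊕ B) :
    star (of x) = (of (Sum.map star star x) : FreeStarAlg A B) :=
  congrArg MulOpposite.unop (starHom_of x)

theorem star_algebraMap (c : ℂ) :
    star (algebraMap ℂ (FreeStarAlg A B) c) = algebraMap ℂ (FreeStarAlg A B) (star c) :=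
  congrArg MulOpposite.unop (starHom_algebraMap c)

instance : StarModule ℂ (FreeStarAlg A B) where
  star_smul c x := by
    rw [Algebra.smul_def, Algebra.smul_def, star_mul, star_algebraMap, Algebra.commutes]

/-- The *-homomorphism determined by *-preserving maps on the letters. -/
def liftStar {A B E : Type*} [CStarAlgebra A] [CStarAlgebra B] [CStarAlgebra E]
    (f : A →⋆ₐ[ℂ] E) (g : B →⋆ₐ[ℂ] E) : FreeStarAlg A B →⋆ₐ[ℂ] E where
  toAlgHom := lift (Sum.elim f g)
  map_star' x := by
    change lift (Sum.elim f g) (star x) = star (lift (Sum.elim f g) x)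
    induction x using induction with
    | hs c => rw [star_algebraMap, AlgHom.commutes, AlgHom.commutes, algebraMap_star_comm]
    | hof x => cases x <;> simp only [star_of, lift_of, Sum.map_inl, Sum.map_inr, Sum.elim_inl,
        Sum.elim_inr, map_star]
    | hadd x y hx hy => rw [star_add, map_add, map_add, star_add, hx, hy]
    | hmul x y hx hy => rw [star_mul, map_mul, map_mul, star_mul, hx, hy]

end FreeStarAlg

/-! ### The full amalgamated free product -/

section AmalgFreeProd

variable {A B D : Type*} [CStarAlgebra A] [CStarAlgebra B] [Semiring D] [Algebra ℂ D] [Star D]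

/-- The defining relations of the full free product of `A` and `B` with amalgamation along
`φ : D → A` and `ψ : D → B`: the letters of `A` satisfy the linear and multiplicative relations
of the unital algebra `A`, the letters of `B` those of `B`, and the letters `φ d` and `ψ d` agree
(the relations for the adjoint already hold in the free *-algebra). -/
inductive AmalgRel (φ : D →⋆ₐ[ℂ] A) (ψ : D →⋆ₐ[ℂ] B) : FreeStarAlg A B → FreeStarAlg A B → Prop
  | add_left (a a' : A) : AmalgRel φ ψ (FreeStarAlg.of (Sum.inl (a + a')))
      (FreeStarAlg.of (Sum.inl a) + FreeStarAlg.of (Sum.inl a'))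
  | smul_left (c : ℂ) (a : A) : AmalgRel φ ψ (FreeStarAlg.of (Sum.inl (c • a)))
      (c • FreeStarAlg.of (Sum.inl a))
  | mul_left (a a' : A) : AmalgRel φ ψ (FreeStarAlg.of (Sum.inl (a * a')))
      (FreeStarAlg.of (Sum.inl a) * FreeStarAlg.of (Sum.inl a'))
  | one_left : AmalgRel φ ψ (FreeStarAlg.of (Sum.inl 1)) 1
  | add_right (b b' : B) : AmalgRel φ ψ (FreeStarAlg.of (Sum.inr (b + b')))
      (FreeStarAlg.of (Sum.inr b) + FreeStarAlg.of (Sum.inr b'))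
  | smul_right (c : ℂ) (b : B) : AmalgRel φ ψ (FreeStarAlg.of (Sum.inr (c • b)))
      (c • FreeStarAlg.of (Sum.inr b))
  | mul_right (b b' : B) : AmalgRel φ ψ (FreeStarAlg.of (Sum.inr (b * b')))
      (FreeStarAlg.of (Sum.inr b) * FreeStarAlg.of (Sum.inr b'))
  | one_right : AmalgRel φ ψ (FreeStarAlg.of (Sum.inr 1)) 1
  | amalg (d : D) : AmalgRel φ ψ (FreeStarAlg.of (Sum.inl (φ d))) (FreeStarAlg.of (Sum.inr (ψ d)))

variable (φ : D →⋆ₐ[ℂ] A) (ψ : D →⋆ₐ[ℂ] B)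

/-- The C*-seminorms on the free *-algebra for which the defining relations hold. -/
def AmalgSeminorm : Type _ :=
  {p : CStarSeminorm (FreeStarAlg A B) // ∀ x y, AmalgRel φ ψ x y → p (x - y) = 0}

namespace AmalgSeminorm

variable {φ ψ}

/-- Related elements have the same image in the completion. -/
theorem toComplHom_eq (p : AmalgSeminorm φ ψ) {x y : FreeStarAlg A B} (h : AmalgRel φ ψ x y) :
    p.1.toComplHom x = p.1.toComplHom y := by
  rw [← sub_eq_zero, ← map_sub, ← norm_eq_zero]
  exact (p.1.norm_toCompl _).trans (p.2 x y h)

/-- The *-homomorphism from `A` to the completion for an admissible seminorm. -/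
def inl (p : AmalgSeminorm φ ψ) : A →⋆ₐ[ℂ] p.1.Compl where
  toFun a := p.1.toComplHom (FreeStarAlg.of (Sum.inl a))
  map_one' := by rw [p.toComplHom_eq .one_left, map_one]
  map_mul' a a' := by rw [p.toComplHom_eq (.mul_left a a'), map_mul]
  map_zero' := by
    have := p.toComplHom_eq (.smul_left 0 (0 : A))
    rwa [zero_smul, zero_smul, map_zero] at this
  map_add' a a' := by rw [p.toComplHom_eq (.add_left a a'), map_add]
  commutes' c := by
    rw [Algebra.algebraMap_eq_smul_one, p.toComplHom_eq (.smul_left c 1), map_smul,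
      p.toComplHom_eq .one_left, map_one, Algebra.algebraMap_eq_smul_one]
  map_star' a := by rw [← map_star, FreeStarAlg.star_of]; rfl

/-- The *-homomorphism from `B` to the completion for an admissible seminorm. -/
def inr (p : AmalgSeminorm φ ψ) : B →⋆ₐ[ℂ] p.1.Compl where
  toFun b := p.1.toComplHom (FreeStarAlg.of (Sum.inr b))
  map_one' := by rw [p.toComplHom_eq .one_right, map_one]
  map_mul' b b' := by rw [p.toComplHom_eq (.mul_right b b'), map_mul]
  map_zero' := by
    have := p.toComplHom_eq (.smul_right 0 (0 : B))
    rwa [zero_smul, zero_smul, map_zero] at this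
  map_add' b b' := by rw [p.toComplHom_eq (.add_right b b'), map_add]
  commutes' c := by
    rw [Algebra.algebraMap_eq_smul_one, p.toComplHom_eq (.smul_right c 1), map_smul,
      p.toComplHom_eq .one_right, map_one, Algebra.algebraMap_eq_smul_one]
  map_star' b := by rw [← map_star, FreeStarAlg.star_of]; rfl

/-- On each element of the free *-algebra the admissible seminorms are uniformly bounded. -/
theorem exists_bound (x : FreeStarAlg A B) : ∃ C, ∀ p : AmalgSeminorm φ ψ, p.1 x ≤ C := by
  induction x using FreeStarAlg.induction with
  | hs c =>
    refine ⟨‖c‖, fun p => ?_⟩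
    rw [Algebra.algebraMap_eq_smul_one, p.1.map_smul]
    refine mul_le_of_le_one_right (norm_nonneg c) ?_
    have h := p.1.star_mul_self 1
    rw [star_one, one_mul] at h
    nlinarith
  | hof x =>
    rcases x with a | b
    · refine ⟨‖a‖, fun p => ?_⟩
      rw [← p.1.norm_toCompl]
      exact NonUnitalStarAlgHom.norm_apply_le p.inl a
    · refine ⟨‖b‖, fun p => ?_⟩
      rw [← p.1.norm_toCompl]
      exact NonUnitalStarAlgHom.norm_apply_le p.inr b
  | hadd x y hx hy =>
    obtain ⟨C, hC⟩ := hx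
    obtain ⟨C', hC'⟩ := hy
    exact ⟨C + C', fun p => (p.1.add_le x y).trans (add_le_add (hC p) (hC' p))⟩
  | hmul x y hx hy =>
    obtain ⟨C, hC⟩ := hx
    obtain ⟨C', hC'⟩ := hy
    exact ⟨C * C', fun p => (p.1.mul_le x y).trans
      (mul_le_mul (hC p) (hC' p) (p.1.nonneg y) ((p.1.nonneg x).trans (hC p)))⟩

theorem bddAbove (x : FreeStarAlg A B) :
    BddAbove (Set.range fun p : AmalgSeminorm φ ψ => p.1 x) := by
  obtain ⟨C, hC⟩ := exists_bound (φ := φ) (ψ := ψ) x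
  exact ⟨C, by rintro _ ⟨p, rfl⟩; exact hC p⟩

instance : Nonempty (AmalgSeminorm φ ψ) :=
  ⟨⟨{ toSeminorm := 0
      mul_le' := fun _ _ => (zero_mul (0 : ℝ)).ge
      star_mul_self' := fun _ => (zero_pow (M₀ := ℝ) two_ne_zero).symm }, fun _ _ _ => rfl⟩⟩

theorem le_iSup (p : AmalgSeminorm φ ψ) (x : FreeStarAlg A B) :
    p.1 x ≤ ⨆ q : AmalgSeminorm φ ψ, q.1 x :=
  le_ciSup (bddAbove x) p

end AmalgSeminorm

/-- The universal (largest) C*-seminorm on the free *-algebra for which the defining relations of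
the amalgamated free product hold. -/
def amalgUniversalSeminorm : CStarSeminorm (FreeStarAlg A B) where
  toSeminorm := Seminorm.of (fun x => ⨆ p : AmalgSeminorm φ ψ, p.1 x)
    (fun x y => ciSup_le fun p => (p.1.add_le x y).trans
      (add_le_add (p.le_iSup x) (p.le_iSup y)))
    (fun c x => by
      rw [Real.mul_iSup_of_nonneg (norm_nonneg c)]
      exact iSup_congr fun p => p.1.map_smul c x)
  mul_le' x y := ciSup_le fun p => (p.1.mul_le x y).trans
    (mul_le_mul (p.le_iSup x) (p.le_iSup y) (p.1.nonneg y)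
      ((p.1.nonneg x).trans (p.le_iSup x)))
  star_mul_self' x := by
    have h0 : 0 ≤ ⨆ p : AmalgSeminorm φ ψ, p.1 x := Real.iSup_nonneg fun p => p.1.nonneg x
    refine le_antisymm (ciSup_le fun p => ?_) ?_
    · rw [p.1.star_mul_self]
      exact pow_le_pow_left₀ (p.1.nonneg x) (p.le_iSup x) 2
    · refine (Real.le_sqrt h0 ?_).1 (ciSup_le fun p => Real.le_sqrt_of_sq_le ?_)
      · exact Real.iSup_nonneg fun p => p.1.nonneg _
      · rw [← p.1.star_mul_self]
        exact p.le_iSup _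

theorem amalgUniversalSeminorm_apply (x : FreeStarAlg A B) :
    amalgUniversalSeminorm φ ψ x = ⨆ p : AmalgSeminorm φ ψ, p.1 x := rfl

/-- The universal C*-seminorm is itself admissible. -/
def amalgUniversal : AmalgSeminorm φ ψ :=
  ⟨amalgUniversalSeminorm φ ψ, fun x y h => by
    rw [amalgUniversalSeminorm_apply]
    simp [fun p : AmalgSeminorm φ ψ => p.2 x y h]⟩

/-- The unital full free product of the unital C*-algebras `A` and `B` with amalgamation over `D`
along the unital *-homomorphisms `φ : D → A` and `ψ : D → B`: the universal unital C*-algebra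
generated by copies of `A` and `B` in which `φ d` and `ψ d` agree for every `d`, constructed as
the completion of the free *-algebra for the universal C*-seminorm. -/
def AmalgFreeProd : Type _ := (amalgUniversal φ ψ).1.Compl

namespace AmalgFreeProd

instance : CStarAlgebra (AmalgFreeProd φ ψ) :=
  inferInstanceAs (CStarAlgebra (amalgUniversal φ ψ).1.Compl)

/-- The canonical map from `A`. -/
def inl : A →⋆ₐ[ℂ] AmalgFreeProd φ ψ := (amalgUniversal φ ψ).inl

/-- The canonical map from `B`. -/
def inr : B →⋆ₐ[ℂ] AmalgFreeProd φ ψ := (amalgUniversal φ ψ).inr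

theorem inl_apply_eq_inr_apply (d : D) : inl φ ψ (φ d) = inr φ ψ (ψ d) :=
  (amalgUniversal φ ψ).toComplHom_eq (.amalg d)

/-- The universal property: *-homomorphisms from `A` and from `B` that agree on `D` have a unique
common extension to the amalgamated free product. -/
theorem existsUnique_lift {E : Type*} [CStarAlgebra E] (f : A →⋆ₐ[ℂ] E) (g : B →⋆ₐ[ℂ] E)
    (h : ∀ d, f (φ d) = g (ψ d)) :
    ∃! π : AmalgFreeProd φ ψ →⋆ₐ[ℂ] E, π.comp (inl φ ψ) = f ∧ π.comp (inr φ ψ) = g := by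
  let ρ : FreeStarAlg A B →⋆ₐ[ℂ] E := FreeStarAlg.liftStar f g
  have hρl (a : A) : ρ (FreeStarAlg.of (Sum.inl a)) = f a := FreeStarAlg.lift_of _ _
  have hρr (b : B) : ρ (FreeStarAlg.of (Sum.inr b)) = g b := FreeStarAlg.lift_of _ _
  have hle (x : FreeStarAlg A B) : ‖ρ x‖ ≤ (amalgUniversal φ ψ).1 x := by
    let q : AmalgSeminorm φ ψ := ⟨CStarSeminorm.ofHom ρ, fun x y hxy => by
      rw [CStarSeminorm.ofHom_apply, norm_eq_zero, map_sub, sub_eq_zero]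
      induction hxy with
      | add_left a a' => rw [map_add, hρl, hρl, hρl, map_add]
      | smul_left c a => rw [map_smul, hρl, hρl, map_smul]
      | mul_left a a' => rw [map_mul, hρl, hρl, hρl, map_mul]
      | one_left => rw [map_one, hρl, map_one]
      | add_right a a' => rw [map_add, hρr, hρr, hρr, map_add]
      | smul_right c a => rw [map_smul, hρr, hρr, map_smul]
      | mul_right a a' => rw [map_mul, hρr, hρr, hρr, map_mul]
      | one_right => rw [map_one, hρr, map_one]
      | amalg d => rw [hρl, hρr, h]⟩
    exact q.le_iSup x
  obtain ⟨π, hπ⟩ := (amalgUniversal φ ψ).1.exists_extension ρ hle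
  refine ⟨π, ⟨StarAlgHom.ext fun a => (hπ _).trans (hρl a),
    StarAlgHom.ext fun b => (hπ _).trans (hρr b)⟩, ?_⟩
  rintro π' ⟨h1, h2⟩
  refine (amalgUniversal φ ψ).1.hom_ext π' π fun x => ?_
  rw [hπ]
  induction x using FreeStarAlg.induction with
  | hs c =>
    rw [AlgHomClass.commutes, AlgHomClass.commutes]
    exact AlgHomClass.commutes π' c
  | hof x =>
    rcases x with a | b
    · exact (DFunLike.congr_fun h1 a).trans (hρl a).symm
    · exact (DFunLike.congr_fun h2 b).trans (hρr b).symm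
  | hadd x y hx hy =>
    rw [map_add, map_add, ← hx, ← hy]
    exact map_add π' _ _
  | hmul x y hx hy =>
    rw [map_mul, map_mul, ← hx, ← hy]
    exact map_mul π' _ _

end AmalgFreeProd

end AmalgFreeProd

/-! ### Bounded sequences modulo null sequences, and MF algebras -/

section MF

variable (M : ℕ → Type*) [∀ n, CStarAlgebra (M n)] [∀ n, Nontrivial (M n)]

/-- The closed two-sided ideal `∑ M n` of the sequences whose norms tend to zero, in the C*-algebra
`∏ M n` of the bounded sequences with the supremum norm. -/
def nullIdeal : Ideal (lp M ∞) where
  carrier := {Y | Tendsto (fun n => ‖Y n‖) atTop (𝓝 0)}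
  zero_mem' := by simp
  add_mem' {Y Z} hY hZ :=
    squeeze_zero (fun n => norm_nonneg _) (fun n => norm_add_le (Y n) (Z n))
      (by simpa using Tendsto.add hY hZ)
  smul_mem' X Y hY := by
    refine squeeze_zero (fun n => norm_nonneg _) (fun n => ?_)
      (by simpa using Tendsto.const_mul ‖X‖ hY)
    exact (norm_mul_le (X n) (Y n)).trans
      (mul_le_mul_of_nonneg_right (lp.norm_apply_le_norm ENNReal.top_ne_zero X n) (norm_nonneg _))

theorem mem_nullIdeal (Y : lp M ∞) :
    Y ∈ nullIdeal M ↔ Tendsto (fun n => ‖Y n‖) atTop (𝓝 0) := Iff.rfl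

instance : (nullIdeal M).IsTwoSided where
  mul_mem_of_left {Y} X hY := by
    refine squeeze_zero (fun n => norm_nonneg _) (fun n => ?_)
      (by simpa using Tendsto.mul_const ‖X‖ hY)
    exact (norm_mul_le (Y n) (X n)).trans
      (mul_le_mul_of_nonneg_left (lp.norm_apply_le_norm ENNReal.top_ne_zero X n) (norm_nonneg _))

theorem star_mem_nullIdeal {Y : lp M ∞} (hY : Y ∈ nullIdeal M) : star Y ∈ nullIdeal M := by
  rw [mem_nullIdeal] at hY ⊢
  simpa using hY

/-- The quotient *-algebra `∏ M n / ∑ M n`. -/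
def ProdModSum : Type _ := lp M ∞ ⧸ nullIdeal M

instance : Ring (ProdModSum M) := inferInstanceAs (Ring (lp M ∞ ⧸ nullIdeal M))

instance : Algebra ℂ (ProdModSum M) := inferInstanceAs (Algebra ℂ (lp M ∞ ⧸ nullIdeal M))

/-- The quotient map. -/
def ProdModSum.mk : lp M ∞ →ₐ[ℂ] ProdModSum M := Ideal.Quotient.mkₐ ℂ (nullIdeal M)

theorem ProdModSum.mk_eq_zero (Y : lp M ∞) :
    ProdModSum.mk M Y = 0 ↔ Tendsto (fun n => ‖Y n‖) atTop (𝓝 0) :=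
  Ideal.Quotient.eq_zero_iff_mem (I := nullIdeal M)

theorem ProdModSum.mk_surjective : Function.Surjective (ProdModSum.mk M) :=
  Ideal.Quotient.mk_surjective

instance : StarRing (ProdModSum M) where
  star := Quotient.map' star fun Y Z h => by
    rw [Submodule.quotientRel_def] at h ⊢
    rw [← star_sub]
    exact star_mem_nullIdeal M h
  star_involutive := by
    rintro ⟨Y⟩
    exact congrArg (ProdModSum.mk M) (star_star Y)
  star_mul := by
    rintro ⟨Y⟩ ⟨Z⟩
    exact congrArg (ProdModSum.mk M) (star_mul Y Z)
  star_add := by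
    rintro ⟨Y⟩ ⟨Z⟩
    exact congrArg (ProdModSum.mk M) (star_add Y Z)

theorem ProdModSum.star_mk (Y : lp M ∞) :
    star (ProdModSum.mk M Y) = ProdModSum.mk M (star Y) := rfl

instance : StarModule ℂ (ProdModSum M) where
  star_smul c x := by
    obtain ⟨Y, rfl⟩ := ProdModSum.mk_surjective M x
    rw [← map_smul, ProdModSum.star_mk, ProdModSum.star_mk, star_smul, map_smul]

end MF

open scoped Matrix.Norms.L2Operator in
/-- A separable C*-algebra is an MF algebra if it embeds as a C*-subalgebra of
`∏ M_{k n}(ℂ) / ∑ M_{k n}(ℂ)` for some sequence `k` of positive integers, that is, if there is an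
injective, not necessarily unital, *-homomorphism into this quotient. The matrix algebras carry the
operator norm. -/
def IsMF (A : Type*) [NonUnitalCStarAlgebra A] : Prop :=
  TopologicalSpace.SeparableSpace A ∧
    ∃ (k : ℕ → ℕ+) (π : A →⋆ₙₐ[ℂ] ProdModSum fun n => Matrix (Fin (k n)) (Fin (k n)) ℂ),
      Function.Injective π

end

/-!
Let `F` be the free *-algebra on the letters of `A` and `B`, and let `p k` and `p` be its universal
C*-seminorms for amalgamation over `Dk k` and over `D`.

The `p k` decrease, since the admissible seminorms become fewer as `k` grows, and they dominate `p`.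
Their infimum is again a C*-seminorm. For it the two copies of `d : D` coincide, being at distance
at most `2 ‖d - d'‖` in `p k` for every `d'` in `Dk k`. So the infimum is admissible for `D`, hence
equal to `p`, and the norms on `F` converge pointwise: this is `tendsto_amalgUniversal`.

It remains to see that a separable C*-algebra `E`, with a dense *-subalgebra on which the norm is a
pointwise limit of norms of *-homomorphisms to MF algebras, is MF (`isMF_of_tendsto_norm`).
An embedding into `∏ M n / ∑ M n` is isometric for the seminorm `limsup ‖Y n‖`, because that
seminorm is a C*-seminorm vanishing exactly on the null sequences. Therefore single coordinates of
representing sequences give maps to matrix algebras that respect finitely many operations, do not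
increase finitely many norms, up to any given error, and almost attain the norm at one prescribed
element (`exists_isApproxHom_of_tendsto_norm`). Such maps, for larger and larger finite parts of a
dense sequence and smaller and smaller errors, combine into one embedding of `E`: an element `x` is
sent to the class of the images of approximants of `x` taken from those finite parts
(`exists_embedding_of_isApproxHom`). It is injective because each term of the dense sequence has
its norm almost attained infinitely often.
-/

/-! ### Infima of decreasing sequences of C*-seminorms -/

namespace CStarSeminorm

variable {F : Type*} [Ring F] [Algebra ℂ F] [StarRing F]

theorem tendsto_iInf_of_antitone {p : ℕ → CStarSeminorm F} (hp : ∀ x, Antitone fun k => p k x)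
    (x : F) : Tendsto (fun k => p k x) atTop (𝓝 (⨅ k, p k x)) :=
  tendsto_atTop_ciInf (hp x) ⟨0, by rintro _ ⟨k, rfl⟩; exact (p k).nonneg x⟩

/-- The pointwise infimum of a decreasing sequence of C*-seminorms. It is a C*-seminorm because the
infimum is a pointwise limit. -/
noncomputable def iInfOfAntitone (p : ℕ → CStarSeminorm F) (hp : ∀ x, Antitone fun k => p k x) :
    CStarSeminorm F where
  toSeminorm := Seminorm.of (fun x => ⨅ k, p k x)
    (fun x y => le_of_tendsto_of_tendsto' (tendsto_iInf_of_antitone hp (x + y))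
      ((tendsto_iInf_of_antitone hp x).add (tendsto_iInf_of_antitone hp y))
      fun k => (p k).add_le x y)
    (fun c x => tendsto_nhds_unique (tendsto_iInf_of_antitone hp (c • x))
      (((tendsto_iInf_of_antitone hp x).const_mul ‖c‖).congr fun k => ((p k).map_smul c x).symm))
  mul_le' x y := le_of_tendsto_of_tendsto' (tendsto_iInf_of_antitone hp (x * y))
      ((tendsto_iInf_of_antitone hp x).mul (tendsto_iInf_of_antitone hp y))
      fun k => (p k).mul_le x y
  star_mul_self' x := tendsto_nhds_unique (tendsto_iInf_of_antitone hp (star x * x))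
      (((tendsto_iInf_of_antitone hp x).pow 2).congr fun k => ((p k).star_mul_self x).symm)

theorem tendsto_iInfOfAntitone (p : ℕ → CStarSeminorm F) (hp : ∀ x, Antitone fun k => p k x)
    (x : F) : Tendsto (fun k => p k x) atTop (𝓝 (iInfOfAntitone p hp x)) :=
  tendsto_iInf_of_antitone hp x

end CStarSeminorm

/-! ### The norm of a bounded sequence modulo null sequences -/

section LimsupSeminorm

theorem bddAbove_norm_tail (M : ℕ → Type*) [∀ n, CStarAlgebra (M n)] (N : ℕ) (Y : lp M ∞) :
    BddAbove (Set.range fun n => ‖Y (n + N)‖) :=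
  ⟨‖Y‖, by rintro _ ⟨n, rfl⟩; exact lp.norm_apply_le_norm ENNReal.top_ne_zero Y _⟩

variable (M : ℕ → Type*) [∀ n, CStarAlgebra (M n)] [∀ n, Nontrivial (M n)]

/-- The C*-seminorm `Y ↦ sup_{n ≥ N} ‖Y n‖` on bounded sequences. -/
noncomputable def tailSeminorm (N : ℕ) : CStarSeminorm (lp M ∞) where
  toSeminorm := Seminorm.of (fun Y => ⨆ n, ‖Y (n + N)‖)
    (fun Y Z => ciSup_le fun n => (norm_add_le (Y (n + N)) (Z (n + N))).trans
      (add_le_add (le_ciSup (bddAbove_norm_tail M N Y) n) (le_ciSup (bddAbove_norm_tail M N Z) n)))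
    (fun c Y => by
      rw [Real.mul_iSup_of_nonneg (norm_nonneg c)]
      exact iSup_congr fun n => norm_smul c (Y (n + N)))
  mul_le' Y Z := ciSup_le fun n => (norm_mul_le (Y (n + N)) (Z (n + N))).trans
    (mul_le_mul (le_ciSup (bddAbove_norm_tail M N Y) n) (le_ciSup (bddAbove_norm_tail M N Z) n)
      (norm_nonneg _) (Real.iSup_nonneg fun _ => norm_nonneg _))
  star_mul_self' Y := by
    have key (n : ℕ) : ‖(star Y * Y : lp M ∞) (n + N)‖ = ‖Y (n + N)‖ ^ 2 :=
      (CStarRing.norm_star_mul_self (x := Y (n + N))).trans (sq _).symm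
    have h0 : 0 ≤ ⨆ n, ‖Y (n + N)‖ := Real.iSup_nonneg fun _ => norm_nonneg _
    change ⨆ n, ‖(star Y * Y : lp M ∞) (n + N)‖ = (⨆ n, ‖Y (n + N)‖) ^ 2
    refine le_antisymm (ciSup_le fun n => ?_) ((Real.le_sqrt h0 ?_).1 (ciSup_le fun n =>
      Real.le_sqrt_of_sq_le ?_))
    · rw [key]
      exact pow_le_pow_left₀ (norm_nonneg _) (le_ciSup (bddAbove_norm_tail M N Y) n) 2
    · exact Real.iSup_nonneg fun _ => norm_nonneg _
    · rw [← key]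
      exact le_ciSup (bddAbove_norm_tail M N (star Y * Y)) n

theorem tailSeminorm_antitone (Y : lp M ∞) : Antitone fun N => tailSeminorm M N Y := by
  intro N N' h
  refine ciSup_le fun n => ?_
  have := le_ciSup (bddAbove_norm_tail M N Y) (n + (N' - N))
  rwa [add_assoc, Nat.sub_add_cancel h] at this

/-- The C*-seminorm `Y ↦ limsup ‖Y n‖` on bounded sequences, as the infimum of the suprema of the
tails. -/
noncomputable def limsupSeminorm : CStarSeminorm (lp M ∞) :=
  CStarSeminorm.iInfOfAntitone (tailSeminorm M) (tailSeminorm_antitone M)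

theorem limsupSeminorm_eventually_lt (Y : lp M ∞) {c : ℝ} (hc : limsupSeminorm M Y < c) :
    ∀ᶠ n in atTop, ‖Y n‖ < c := by
  obtain ⟨N, hN⟩ := ((CStarSeminorm.tendsto_iInfOfAntitone _ (tailSeminorm_antitone M) Y).eventually
    (gt_mem_nhds hc)).exists
  filter_upwards [eventually_ge_atTop N] with n hn
  have := le_ciSup (bddAbove_norm_tail M N Y) (n - N)
  rw [Nat.sub_add_cancel hn] at this
  exact this.trans_lt hN

theorem limsupSeminorm_frequently_lt (Y : lp M ∞) {c : ℝ} (hc : c < limsupSeminorm M Y) :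
    ∃ᶠ n in atTop, c < ‖Y n‖ := by
  rw [frequently_atTop]
  intro N
  have hN : c < ⨆ n, ‖Y (n + N)‖ :=
    hc.trans_le ((tailSeminorm_antitone M Y).le_of_tendsto
      (CStarSeminorm.tendsto_iInfOfAntitone _ (tailSeminorm_antitone M) Y) N)
  obtain ⟨n, hn⟩ := exists_lt_of_lt_ciSup hN
  exact ⟨n + N, Nat.le_add_left N n, hn⟩

theorem limsupSeminorm_eq_zero (Y : lp M ∞) :
    limsupSeminorm M Y = 0 ↔ Tendsto (fun n => ‖Y n‖) atTop (𝓝 0) := by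
  constructor
  · intro h
    refine Metric.tendsto_nhds.2 fun ε hε => ?_
    filter_upwards [limsupSeminorm_eventually_lt M Y (h.trans_lt hε)] with n hn
    simpa using hn
  · intro h
    by_contra hne
    have hpos := lt_of_le_of_ne ((limsupSeminorm M).nonneg Y) (Ne.symm hne)
    obtain ⟨n, h1, h2⟩ := ((limsupSeminorm_frequently_lt M Y (half_lt_self hpos)).and_eventually
      (h.eventually (gt_mem_nhds (half_pos hpos)))).exists
    exact lt_asymm h1 h2

/-- The quotient `∏ M n / ∑ M n` inside a C*-algebra, the completion of the bounded sequences for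
the seminorm `limsup ‖Y n‖`. -/
noncomputable def ProdModSum.toLimsupCompl : ProdModSum M →⋆ₐ[ℂ] (limsupSeminorm M).Compl where
  toAlgHom := Ideal.Quotient.liftₐ (nullIdeal M) ((limsupSeminorm M).toComplHom : lp M ∞ →ₐ[ℂ] _)
    fun Y hY => norm_eq_zero.1 <| ((limsupSeminorm M).norm_toCompl Y).trans <|
      (limsupSeminorm_eq_zero M Y).2 hY
  map_star' := by
    rintro ⟨Y⟩
    exact StarHomClass.map_star (limsupSeminorm M).toComplHom Y

theorem ProdModSum.norm_toLimsupCompl_mk (Y : lp M ∞) :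
    ‖ProdModSum.toLimsupCompl M (ProdModSum.mk M Y)‖ = limsupSeminorm M Y :=
  (limsupSeminorm M).norm_toCompl Y

theorem ProdModSum.toLimsupCompl_injective : Function.Injective (ProdModSum.toLimsupCompl M) := by
  refine (injective_iff_map_eq_zero _).2 fun x hx => ?_
  obtain ⟨Y, rfl⟩ := ProdModSum.mk_surjective M x
  rw [← norm_eq_zero, ProdModSum.norm_toLimsupCompl_mk] at hx
  exact (ProdModSum.mk_eq_zero M Y).2 ((limsupSeminorm_eq_zero M Y).1 hx)

/-- An embedding of a C*-algebra into `∏ M n / ∑ M n` is isometric: a representing sequence of the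
image of `a` has `limsup ‖Y n‖ = ‖a‖`. -/
theorem limsupSeminorm_eq_norm {A : Type*} [NonUnitalCStarAlgebra A] {π : A →⋆ₙₐ[ℂ] ProdModSum M}
    (hπ : Function.Injective π) {a : A} {Y : lp M ∞} (hY : ProdModSum.mk M Y = π a) :
    limsupSeminorm M Y = ‖a‖ := by
  let τ : ProdModSum M →⋆ₙₐ[ℂ] (limsupSeminorm M).Compl :=
    { ProdModSum.toLimsupCompl M with
      map_smul' := fun c x => _root_.map_smul (ProdModSum.toLimsupCompl M) c x
      map_zero' := _root_.map_zero (ProdModSum.toLimsupCompl M) }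
  rw [← ProdModSum.norm_toLimsupCompl_mk, hY]
  exact NonUnitalStarAlgHom.norm_map (τ.comp π)
    ((ProdModSum.toLimsupCompl_injective M).comp hπ) a

end LimsupSeminorm

/-! ### Approximate *-homomorphisms into matrix algebras -/

/-- The map `σ` respects the *-algebra operations on the elements of `T` and scalars of `C` up to
the error prescribed by `ν`. The result of an operation is tested against a further element `z` of
`T`, so that `T` need not be closed under the operations; typically `ν` is a C*-seminorm plus a
small constant. -/
structure IsApproxHom {F M : Type*} [Ring F] [Algebra ℂ F] [StarRing F] [CStarAlgebra M]
    (ν : F → ℝ) (T : Set F) (C : Set ℂ) (σ : F → M) : Prop where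
  norm_le : ∀ x ∈ T, ‖σ x‖ ≤ ν x
  sub_le : ∀ x ∈ T, ∀ z ∈ T, ‖σ x - σ z‖ ≤ ν (x - z)
  add_le : ∀ x ∈ T, ∀ y ∈ T, ∀ z ∈ T, ‖σ x + σ y - σ z‖ ≤ ν (x + y - z)
  mul_le : ∀ x ∈ T, ∀ y ∈ T, ∀ z ∈ T, ‖σ x * σ y - σ z‖ ≤ ν (x * y - z)
  smul_le : ∀ c ∈ C, ∀ x ∈ T, ∀ z ∈ T, ‖c • σ x - σ z‖ ≤ ν (c • x - z)
  star_le : ∀ x ∈ T, ∀ z ∈ T, ‖star (σ x) - σ z‖ ≤ ν (star x - z)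

/-- For bounded sequences `Y f` that represent the values of a *-homomorphism to `∏ M n / ∑ M n`,
the maps `f ↦ Y f n` are eventually approximate *-homomorphisms. -/
theorem eventually_isApproxHom {F : Type*} [Ring F] [Algebra ℂ F] [StarRing F]
    (M : ℕ → Type*) [∀ n, CStarAlgebra (M n)] [∀ n, Nontrivial (M n)]
    (ρ : F →⋆ₙₐ[ℂ] ProdModSum M) (Y : F → lp M ∞) (hY : ∀ f, ProdModSum.mk M (Y f) = ρ f)
    (ν : F → ℝ) (hν : ∀ f Z, ProdModSum.mk M Z = ρ f → limsupSeminorm M Z < ν f)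
    {T : Set F} (hT : T.Finite) {C : Set ℂ} (hC : C.Finite) :
    ∀ᶠ n in atTop, IsApproxHom ν T C fun f => Y f n := by
  have key (f : F) (Z : lp M ∞) (h : ProdModSum.mk M Z = ρ f) : ∀ᶠ n in atTop, ‖Z n‖ ≤ ν f :=
    (limsupSeminorm_eventually_lt M Z (hν f Z h)).mono fun n hn => hn.le
  have h1 : ∀ᶠ n in atTop, ∀ x ∈ T, ‖Y x n‖ ≤ ν x :=
    (eventually_all_finite hT).2 fun x _ => key x _ (hY x)
  have h2 : ∀ᶠ n in atTop, ∀ x ∈ T, ∀ z ∈ T, ‖Y x n - Y z n‖ ≤ ν (x - z) :=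
    (eventually_all_finite hT).2 fun x _ => (eventually_all_finite hT).2 fun z _ =>
      key (x - z) (Y x - Y z) (by rw [map_sub, map_sub, hY, hY])
  have h3 : ∀ᶠ n in atTop, ∀ x ∈ T, ∀ y ∈ T, ∀ z ∈ T,
      ‖Y x n + Y y n - Y z n‖ ≤ ν (x + y - z) :=
    (eventually_all_finite hT).2 fun x _ => (eventually_all_finite hT).2 fun y _ =>
      (eventually_all_finite hT).2 fun z _ =>
      key (x + y - z) (Y x + Y y - Y z) (by rw [map_sub, map_sub, map_add, map_add, hY, hY, hY])
  have h4 : ∀ᶠ n in atTop, ∀ x ∈ T, ∀ y ∈ T, ∀ z ∈ T,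
      ‖Y x n * Y y n - Y z n‖ ≤ ν (x * y - z) :=
    (eventually_all_finite hT).2 fun x _ => (eventually_all_finite hT).2 fun y _ =>
      (eventually_all_finite hT).2 fun z _ =>
      key (x * y - z) (Y x * Y y - Y z) (by rw [map_sub, map_sub, map_mul, map_mul, hY, hY, hY])
  have h5 : ∀ᶠ n in atTop, ∀ c ∈ C, ∀ x ∈ T, ∀ z ∈ T, ‖c • Y x n - Y z n‖ ≤ ν (c • x - z) :=
    (eventually_all_finite hC).2 fun c _ => (eventually_all_finite hT).2 fun x _ =>
      (eventually_all_finite hT).2 fun z _ =>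
      key (c • x - z) (c • Y x - Y z) (by rw [map_sub, map_sub, map_smul, map_smul, hY, hY])
  have h6 : ∀ᶠ n in atTop, ∀ x ∈ T, ∀ z ∈ T, ‖star (Y x n) - Y z n‖ ≤ ν (star x - z) :=
    (eventually_all_finite hT).2 fun x _ => (eventually_all_finite hT).2 fun z _ =>
      key (star x - z) (star (Y x) - Y z)
        (by rw [map_sub, map_sub, ← ProdModSum.star_mk, map_star, hY, hY])
  filter_upwards [h1, h2, h3, h4, h5, h6] with n h1 h2 h3 h4 h5 h6
  exact ⟨h1, h2, h3, h4, h5, h6⟩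

open scoped Pointwise in
theorem IsApproxHom.mono {F M : Type*} [Ring F] [Algebra ℂ F] [StarRing F] [CStarAlgebra M]
    {ν ν' : F → ℝ} {T : Set F} {C : Set ℂ} {σ : F → M} (h : IsApproxHom ν T C σ)
    (hν : ∀ f ∈ T ∪ (T - T) ∪ (T + T - T) ∪ (T * T - T) ∪ (C • T - T) ∪ (star T - T),
      ν f ≤ ν' f) : IsApproxHom ν' T C σ where
  norm_le x hx := (h.norm_le x hx).trans <| hν _ <| by simp [hx]
  sub_le x hx z hz := (h.sub_le x hx z hz).trans <| hν _ <| by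
    simp only [Set.mem_union, Set.sub_mem_sub hx hz, true_or, or_true]
  add_le x hx y hy z hz := (h.add_le x hx y hy z hz).trans <| hν _ <| by
    simp only [Set.mem_union, Set.sub_mem_sub (Set.add_mem_add hx hy) hz, true_or, or_true]
  mul_le x hx y hy z hz := (h.mul_le x hx y hy z hz).trans <| hν _ <| by
    simp only [Set.mem_union, Set.sub_mem_sub (Set.mul_mem_mul hx hy) hz, true_or, or_true]
  smul_le c hc x hx z hz := (h.smul_le c hc x hx z hz).trans <| hν _ <| by
    simp only [Set.mem_union, Set.sub_mem_sub (Set.smul_mem_smul hc hx) hz, true_or, or_true]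
  star_le x hx z hz := (h.star_le x hx z hz).trans <| hν _ <| by
    simp only [Set.mem_union, Set.sub_mem_sub (Set.star_mem_star.2 hx) hz, or_true]

open scoped Matrix.Norms.L2Operator in
/-- If the norms of *-homomorphisms `ι' k` to MF algebras tend pointwise to that of `ι`, then there
are approximate *-homomorphisms to matrix algebras for the norm of `ι`, which almost attain the norm
at one prescribed element `f₀`. -/
theorem exists_isApproxHom_of_tendsto_norm {F E : Type*} [Ring F] [Algebra ℂ F] [StarRing F]
    [CStarAlgebra E] (ι : F →⋆ₐ[ℂ] E) {E' : ℕ → Type*} [∀ k, CStarAlgebra (E' k)]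
    (hMF : ∀ k, IsMF (E' k)) (ι' : ∀ k, F →⋆ₐ[ℂ] E' k)
    (hι : ∀ f, Tendsto (fun k => ‖ι' k f‖) atTop (𝓝 ‖ι f‖))
    {T : Set F} (hT : T.Finite) {C : Set ℂ} (hC : C.Finite) (f₀ : F) {ε : ℝ} (hε : 0 < ε) :
    ∃ (m : ℕ+) (σ : F → Matrix (Fin m) (Fin m) ℂ),
      IsApproxHom (fun f => ‖ι f‖ + ε) T C σ ∧ ‖ι f₀‖ - ε ≤ ‖σ f₀‖ := by
  open scoped Pointwise in
  have hfin : (T ∪ (T - T) ∪ (T + T - T) ∪ (T * T - T) ∪ (C • T - T) ∪ (star T - T)).Finite :=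
    ((((hT.union (hT.sub hT)).union ((hT.add hT).sub hT)).union ((hT.mul hT).sub hT)).union
      ((hC.smul hT).sub hT)).union (hT.star.sub hT)
  obtain ⟨k, hk, hk₀⟩ := (((eventually_all_finite hfin).2 fun f _ =>
    (hι f).eventually (gt_mem_nhds (lt_add_of_pos_right ‖ι f‖ (half_pos hε)))).and
    ((hι f₀).eventually (lt_mem_nhds (sub_lt_self ‖ι f₀‖ (half_pos hε))))).exists
  obtain ⟨-, m, π, hπ⟩ := hMF k
  choose Y hY using fun f => ProdModSum.mk_surjective _ (π (ι' k f))
  have hnorm (f : F) (Z) (h : ProdModSum.mk _ Z = π (ι' k f)) := limsupSeminorm_eq_norm _ hπ h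
  let ι'' : F →⋆ₙₐ[ℂ] E' k :=
    { ι' k with
      map_smul' := fun c x => map_smul (ι' k) c x
      map_zero' := map_zero (ι' k) }
  have hev := eventually_isApproxHom _ (π.comp ι'') Y hY (fun f => ‖ι' k f‖ + ε / 2)
    (fun f Z h => (hnorm f Z h).trans_lt (lt_add_of_pos_right _ (half_pos hε))) hT hC
  have hfr := limsupSeminorm_frequently_lt _ (Y f₀) (c := ‖ι f₀‖ - ε)
    (by rw [hnorm f₀ _ (hY f₀)]; linarith)
  obtain ⟨n, hn₀, hn⟩ := (hfr.and_eventually hev).exists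
  refine ⟨m n, _, hn.mono fun f hf => ?_, hn₀.le⟩
  linarith [hk f hf]

/-! ### Assembling approximate *-homomorphisms along a dense sequence -/

/-- Points of a space with a dense sequence `g` are limits of terms `g (N x j)` with `N x j ≤ j`:
a nearest point among the first terms will do. -/
theorem exists_index_le_tendsto {X : Type*} [PseudoMetricSpace X] {g : ℕ → X} (hg : DenseRange g) :
    ∃ N : X → ℕ → ℕ, (∀ x j, N x j ≤ j) ∧ ∀ x, Tendsto (fun j => g (N x j)) atTop (𝓝 x) := by
  have h (x : X) (j : ℕ) : ∃ i ∈ Finset.range (j + 1), ∀ i' ∈ Finset.range (j + 1),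
      dist (g i) x ≤ dist (g i') x :=
    Finset.exists_min_image _ _ ⟨0, by simp⟩
  choose N hN hmin using h
  refine ⟨N, fun x j => Nat.lt_succ_iff.1 (Finset.mem_range.1 (hN x j)), fun x => ?_⟩
  refine Metric.tendsto_nhds.2 fun ε hε => ?_
  obtain ⟨i, hi⟩ := hg.exists_dist_lt x hε
  filter_upwards [eventually_ge_atTop i] with j hj
  refine (hmin x j i (Finset.mem_range.2 (Nat.lt_succ_iff.2 hj))).trans_lt ?_
  rwa [dist_comm]

theorem DenseRange.exists_dense_comp {X F : Type*} [PseudoMetricSpace X]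
    [TopologicalSpace.SeparableSpace X] [Nonempty F] {ι : F → X} (hι : DenseRange ι) :
    ∃ f : ℕ → F, DenseRange fun i => ι (f i) := by
  have : SecondCountableTopology X := UniformSpace.secondCountable_of_separable X
  obtain ⟨t, ht, htc, htd⟩ := Dense.exists_countable_dense_subset (s := Set.range ι) hι
  have : Nonempty X := ⟨ι (Classical.arbitrary F)⟩
  obtain ⟨g, rfl⟩ := htc.exists_eq_range htd.nonempty
  choose f hf using fun i => ht ⟨i, rfl⟩
  exact ⟨f, by simpa only [hf, DenseRange] using htd⟩

/-- Maps `σ j` that are approximate *-homomorphisms on the terms up to the `j`-th of a dense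
sequence, with errors tending to zero, assemble to an embedding into `∏ M j / ∑ M j`: the image of
`x` is the class of the sequence `σ j (r x j)`, where `r x j → x` and `r x j` is among these terms.
The element at which `σ j` almost attains the norm has to run through all terms infinitely often. -/
theorem exists_embedding_of_isApproxHom {F E : Type*} [Ring F] [Algebra ℂ F] [StarRing F]
    [CStarAlgebra E] (ι : F →⋆ₐ[ℂ] E) {f : ℕ → F} (hf : DenseRange fun i => ι (f i))
    {g : ℕ → ℂ} (hg : DenseRange g)
    (M : ℕ → Type*) [∀ n, CStarAlgebra (M n)] [∀ n, Nontrivial (M n)] {σ : ∀ j, F → M j}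
    (hσ : ∀ j : ℕ, IsApproxHom (fun x => ‖ι x‖ + 1 / ((j : ℝ) + 1)) (f '' Set.Iic j)
      (g '' Set.Iic j) (σ j))
    {i₀ : ℕ → ℕ} (hi₀ : ∀ i, ∃ᶠ j in atTop, i₀ j = i)
    (hσ₀ : ∀ j : ℕ, ‖ι (f (i₀ j))‖ - 1 / ((j : ℝ) + 1) ≤ ‖σ j (f (i₀ j))‖) :
    ∃ π : E →⋆ₙₐ[ℂ] ProdModSum M, Function.Injective π := by
  obtain ⟨N, hN, hNlim⟩ := exists_index_le_tendsto hf
  obtain ⟨S, hS, hSlim⟩ := exists_index_le_tendsto hg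
  let r (x : E) (j : ℕ) : F := f (N x j)
  let s (c : ℂ) (j : ℕ) : ℂ := g (S c j)
  have hr (x : E) : Tendsto (fun j => ι (r x j)) atTop (𝓝 x) := hNlim x
  have hs (c : ℂ) : Tendsto (s c) atTop (𝓝 c) := hSlim c
  have hrmem (x : E) (j : ℕ) : r x j ∈ f '' Set.Iic j := ⟨_, hN x j, rfl⟩
  have hsmem (c : ℂ) (j : ℕ) : s c j ∈ g '' Set.Iic j := ⟨_, hS c j, rfl⟩
  have hε : Tendsto (fun j : ℕ => 1 / ((j : ℝ) + 1)) atTop (𝓝 0) :=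
    tendsto_one_div_add_atTop_nhds_zero_nat
  let τ (x : E) (j : ℕ) : M j := σ j (r x j)
  have hbdd (x : E) : BddAbove (Set.range fun j => ‖τ x j‖) := by
    obtain ⟨b, hb⟩ := ((hr x).norm.add hε).bddAbove_range
    refine ⟨b, ?_⟩
    rintro _ ⟨j, rfl⟩
    exact ((hσ j).norm_le _ (hrmem x j)).trans (hb ⟨j, rfl⟩)
  let Θ (x : E) : lp M ∞ := ⟨τ x, memℓp_infty (hbdd x)⟩
  -- Errors bounded by the norms of a null sequence of `E` vanish in the quotient.
  have hnull {e : ∀ j, M j} {u : ℕ → F} (he : ∀ j, ‖e j‖ ≤ ‖ι (u j)‖ + 1 / ((j : ℝ) + 1))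
      (hu : Tendsto (fun j => ι (u j)) atTop (𝓝 0)) : Tendsto (fun j => ‖e j‖) atTop (𝓝 0) :=
    squeeze_zero (fun _ => norm_nonneg _) he (by simpa using hu.norm.add hε)
  have heq {Y Z : lp M ∞} (hYZ : Tendsto (fun j => ‖Y j - Z j‖) atTop (𝓝 0)) :
      ProdModSum.mk M Y = ProdModSum.mk M Z := by
    rw [← sub_eq_zero, ← map_sub, ProdModSum.mk_eq_zero]
    exact hYZ
  have hsmul (c : ℂ) (x : E) : ProdModSum.mk M (Θ (c • x)) = c • ProdModSum.mk M (Θ x) := by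
    rw [← map_smul]
    refine (heq ?_).symm
    -- `σ j` is only known to respect the scalars `g i` with `i ≤ j`; they approximate `c`.
    have h1 : Tendsto (fun j => ‖s c j • τ x j - τ (c • x) j‖) atTop (𝓝 0) := by
      refine hnull (fun j => (hσ j).smul_le _ (hsmem c j) _ (hrmem x j) _ (hrmem (c • x) j)) ?_
      simpa using ((hs c).smul (hr x)).sub (hr (c • x))
    obtain ⟨b, hb⟩ := hbdd x
    have h2 : Tendsto (fun j => ‖(c - s c j) • τ x j‖) atTop (𝓝 0) := by
      refine squeeze_zero (fun _ => norm_nonneg _) (fun j => (norm_smul_le _ _).trans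
        (mul_le_mul_of_nonneg_left (hb ⟨j, rfl⟩) (norm_nonneg _))) ?_
      have := ((tendsto_const_nhds (x := c)).sub (hs c)).norm.mul_const b
      simpa using this
    refine squeeze_zero (fun _ => norm_nonneg _) (fun j => ?_) (by simpa using h2.add h1)
    refine le_trans (le_of_eq ?_) (norm_add_le _ _)
    congr 1
    change c • τ x j - τ (c • x) j = _
    rw [sub_smul]
    abel
  have hadd (x y : E) :
      ProdModSum.mk M (Θ (x + y)) = ProdModSum.mk M (Θ x) + ProdModSum.mk M (Θ y) := by
    rw [← map_add]
    refine (heq (hnull (fun j =>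
      (hσ j).add_le _ (hrmem x j) _ (hrmem y j) _ (hrmem (x + y) j)) ?_)).symm
    simpa using ((hr x).add (hr y)).sub (hr (x + y))
  have hmul (x y : E) :
      ProdModSum.mk M (Θ (x * y)) = ProdModSum.mk M (Θ x) * ProdModSum.mk M (Θ y) := by
    rw [← map_mul]
    refine (heq (hnull (fun j =>
      (hσ j).mul_le _ (hrmem x j) _ (hrmem y j) _ (hrmem (x * y) j)) ?_)).symm
    simpa using ((hr x).mul (hr y)).sub (hr (x * y))
  have hstar (x : E) : ProdModSum.mk M (Θ (star x)) = star (ProdModSum.mk M (Θ x)) := by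
    rw [ProdModSum.star_mk]
    refine (heq (hnull (fun j =>
      (hσ j).star_le _ (hrmem x j) _ (hrmem (star x) j)) ?_)).symm
    simpa [map_star] using (hr x).star.sub (hr (star x))
  refine ⟨
    { toFun := fun x => ProdModSum.mk M (Θ x)
      map_smul' := hsmul
      map_zero' := by simpa using hsmul 0 0
      map_add' := hadd
      map_mul' := hmul
      map_star' := hstar }, (injective_iff_map_eq_zero _).2 fun x hx => ?_⟩
  -- A term `f i` close to a nonzero `x` keeps its norm under `σ j` for infinitely many `j`, so
  -- `‖σ j (r x j)‖` cannot tend to zero.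
  by_contra hne
  have hx0 : Tendsto (fun j => ‖τ x j‖) atTop (𝓝 0) := (ProdModSum.mk_eq_zero M (Θ x)).1 hx
  have hδ : 0 < ‖x‖ / 4 := by have := norm_pos_iff.2 hne; positivity
  obtain ⟨i, hi⟩ := hf.exists_dist_lt x hδ
  rw [dist_eq_norm] at hi
  obtain ⟨j, hj, hij, hj1, hj2, hj3⟩ := ((hi₀ i).and_eventually ((eventually_ge_atTop i).and
    ((hε.eventually (gt_mem_nhds (half_pos hδ))).and
    ((hx0.eventually (gt_mem_nhds (half_pos hδ))).and
    ((hr x).eventually (Metric.ball_mem_nhds x (half_pos hδ))))))).exists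
  have hlow := hσ₀ j
  rw [hj] at hlow
  have hsub := (hσ j).sub_le (f i) ⟨i, hij, rfl⟩ _ (hrmem x j)
  rw [dist_eq_norm] at hj3
  rw [map_sub] at hsub
  have t1 := norm_sub_norm_le (σ j (f i)) (σ j (r x j))
  have t2 := norm_sub_norm_le x (ι (f i))
  have t3 := norm_sub_le_norm_sub_add_norm_sub (ι (f i)) x (ι (r x j))
  rw [norm_sub_rev (ι (f i)) x, norm_sub_rev x (ι (r x j))] at t3
  have t4 : ‖σ j (r x j)‖ < ‖x‖ / 4 / 2 := hj2
  linarith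

open scoped Matrix.Norms.L2Operator in
/-- A separable C*-algebra is MF if it admits approximate *-homomorphisms to matrix algebras, on
finite subsets of a dense *-subalgebra, that almost attain the norm at any one prescribed
element. -/
theorem isMF_of_exists_isApproxHom {F E : Type*} [Ring F] [Algebra ℂ F] [StarRing F]
    [CStarAlgebra E] [TopologicalSpace.SeparableSpace E] (ι : F →⋆ₐ[ℂ] E) (hι : DenseRange ι)
    (h : ∀ T : Set F, T.Finite → ∀ C : Set ℂ, C.Finite → ∀ f₀ : F, ∀ ε : ℝ, 0 < ε →
      ∃ (m : ℕ+) (σ : F → Matrix (Fin m) (Fin m) ℂ),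
        IsApproxHom (fun f => ‖ι f‖ + ε) T C σ ∧ ‖ι f₀‖ - ε ≤ ‖σ f₀‖) :
    IsMF E := by
  obtain ⟨f, hf⟩ := hι.exists_dense_comp
  -- Through the pairing function, the first coordinate takes every value infinitely often.
  choose m σ hσ hσ₀ using fun j : ℕ => h (f '' Set.Iic j) ((Set.finite_Iic j).image f)
    (TopologicalSpace.denseSeq ℂ '' Set.Iic j) ((Set.finite_Iic j).image _) (f (Nat.unpair j).1)
    (1 / ((j : ℝ) + 1)) Nat.one_div_pos_of_nat
  have hfreq (i : ℕ) : ∃ᶠ j in atTop, (Nat.unpair j).1 = i := by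
    refine frequently_atTop.2 fun n => ⟨Nat.pair i n, Nat.right_le_pair i n, ?_⟩
    rw [Nat.unpair_pair]
  exact ⟨inferInstance, m, exists_embedding_of_isApproxHom ι hf
    (TopologicalSpace.denseRange_denseSeq ℂ) _ hσ hfreq hσ₀⟩

/-- A separable C*-algebra with a dense *-subalgebra whose norm is the pointwise limit of seminorms
coming from MF algebras is MF. -/
theorem isMF_of_tendsto_norm {F E : Type*} [Ring F] [Algebra ℂ F] [StarRing F]
    [CStarAlgebra E] [TopologicalSpace.SeparableSpace E] (ι : F →⋆ₐ[ℂ] E) (hdense : DenseRange ι)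
    {E' : ℕ → Type*} [∀ k, CStarAlgebra (E' k)] (hMF : ∀ k, IsMF (E' k))
    (ι' : ∀ k, F →⋆ₐ[ℂ] E' k) (hι : ∀ f, Tendsto (fun k => ‖ι' k f‖) atTop (𝓝 ‖ι f‖)) :
    IsMF E :=
  isMF_of_exists_isApproxHom ι hdense fun _ hT _ hC f₀ _ hε =>
    exists_isApproxHom_of_tendsto_norm ι hMF ι' hι hT hC f₀ hε

/-! ### Amalgamation over an increasing sequence of subalgebras -/

section Amalg

variable {A B D : Type*} [CStarAlgebra A] [CStarAlgebra B] [CStarAlgebra D]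

/-- A seminorm admissible for amalgamation over `K` is admissible for amalgamation over a smaller
subalgebra `L`. -/
noncomputable def AmalgSeminorm.restrict {φ : D →⋆ₐ[ℂ] A} {ψ : D →⋆ₐ[ℂ] B}
    {L K : StarSubalgebra ℂ D}
    (h : L ≤ K) (p : AmalgSeminorm (φ.comp K.subtype) (ψ.comp K.subtype)) :
    AmalgSeminorm (φ.comp L.subtype) (ψ.comp L.subtype) :=
  ⟨p.1, fun x y hxy => by
    apply p.2
    cases hxy with
    | amalg d => exact .amalg (D := K) ⟨d, h d.2⟩
    | _ => constructor⟩

/-- A seminorm admissible for amalgamation over `D` is admissible for amalgamation over a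
subalgebra. -/
noncomputable def AmalgSeminorm.restrictTop {φ : D →⋆ₐ[ℂ] A} {ψ : D →⋆ₐ[ℂ] B}
    (L : StarSubalgebra ℂ D)
    (p : AmalgSeminorm φ ψ) : AmalgSeminorm (φ.comp L.subtype) (ψ.comp L.subtype) :=
  ⟨p.1, fun x y hxy => by
    apply p.2
    cases hxy with
    | amalg d => exact .amalg (d : D)
    | _ => constructor⟩

/-- For a seminorm admissible for amalgamation over `L`, the two copies of `d : D` are at distance
at most `2 ‖d - d'‖` for each `d'` in `L`. -/
theorem AmalgSeminorm.apply_sub_le {φ : D →⋆ₐ[ℂ] A} {ψ : D →⋆ₐ[ℂ] B} {L : StarSubalgebra ℂ D}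
    (p : AmalgSeminorm (φ.comp L.subtype) (ψ.comp L.subtype)) (d : D) {d' : D} (hd' : d' ∈ L) :
    p.1 (FreeStarAlg.of (Sum.inl (φ d)) - FreeStarAlg.of (Sum.inr (ψ d))) ≤ 2 * ‖d - d'‖ := by
  have h1 : ‖p.inl (φ d) - p.inr (ψ d)‖ =
      p.1 (FreeStarAlg.of (Sum.inl (φ d)) - FreeStarAlg.of (Sum.inr (ψ d))) := by
    rw [← p.1.norm_toCompl]
    exact congrArg norm (map_sub p.1.toComplHom _ _).symm
  have h2 : p.inl (φ d') = p.inr (ψ d') := p.toComplHom_eq (.amalg (D := L) ⟨d', hd'⟩)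
  have h3 : p.inl (φ d) - p.inr (ψ d) = p.inl (φ (d - d')) - p.inr (ψ (d - d')) := by
    simp only [map_sub, h2]
    abel
  have h4 : ‖p.inl (φ (d - d'))‖ ≤ ‖d - d'‖ :=
    NonUnitalStarAlgHom.norm_apply_le (p.inl.comp φ) (d - d')
  have h5 : ‖p.inr (ψ (d - d'))‖ ≤ ‖d - d'‖ :=
    NonUnitalStarAlgHom.norm_apply_le (p.inr.comp ψ) (d - d')
  rw [← h1, h3]
  linarith [norm_sub_le (p.inl (φ (d - d'))) (p.inr (ψ (d - d')))]

/-- The universal seminorms for amalgamation over an increasing sequence of subalgebras decrease to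
the one for amalgamation over the closure of the union. Their infimum satisfies all relations
over `D`, since the two copies of `D` in the completion agree on a dense subset. -/
theorem tendsto_amalgUniversal (φ : D →⋆ₐ[ℂ] A) (ψ : D →⋆ₐ[ℂ] B) {Dk : ℕ → StarSubalgebra ℂ D}
    (hmono : Monotone Dk) (hdense : Dense (⋃ k, (Dk k : Set D))) (x : FreeStarAlg A B) :
    Tendsto (fun k => (amalgUniversal (φ.comp (Dk k).subtype) (ψ.comp (Dk k).subtype)).1 x) atTop
      (𝓝 ((amalgUniversal φ ψ).1 x)) := by
  let P (k : ℕ) := amalgUniversal (φ.comp (Dk k).subtype) (ψ.comp (Dk k).subtype)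
  have hanti (y) : Antitone fun k => (P k).1 y := fun j k hjk =>
    ((P k).restrict (hmono hjk)).le_iSup y
  let q := CStarSeminorm.iInfOfAntitone (fun k => (P k).1) hanti
  have hq (y) : Tendsto (fun k => (P k).1 y) atTop (𝓝 (q y)) :=
    CStarSeminorm.tendsto_iInfOfAntitone _ hanti y
  have hqle (k) (y) : q y ≤ (P k).1 y := (hanti y).le_of_tendsto (hq y) k
  have hq0 {y} (h : ∀ k, (P k).1 y = 0) : q y = 0 :=
    le_antisymm ((hqle 0 y).trans (h 0).le) (q.nonneg y)
  let Q : AmalgSeminorm φ ψ := ⟨q, fun y z hyz => by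
    cases hyz with
    | amalg d =>
      refine le_antisymm (le_of_forall_pos_le_add fun ε hε => ?_) (q.nonneg _)
      obtain ⟨d', hd', hdd'⟩ := hdense.exists_dist_lt d (half_pos hε)
      obtain ⟨k, hk⟩ := Set.mem_iUnion.1 hd'
      rw [dist_eq_norm] at hdd'
      linarith [(hqle k _).trans ((P k).apply_sub_le d hk)]
    | _ => exact hq0 fun k => (P k).2 _ _ (by constructor)⟩
  have heq : q x = (amalgUniversal φ ψ).1 x :=
    le_antisymm (Q.le_iSup x) (ge_of_tendsto' (hq x) fun k =>
      ((amalgUniversal φ ψ).restrictTop (Dk k)).le_iSup x)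
  exact heq ▸ hq x

/-- The canonical *-homomorphism from the free *-algebra to the amalgamated free product. -/
noncomputable def AmalgFreeProd.ofFree {L : Type*} [Semiring L] [Algebra ℂ L] [Star L]
    (φ : L →⋆ₐ[ℂ] A) (ψ : L →⋆ₐ[ℂ] B) : FreeStarAlg A B →⋆ₐ[ℂ] AmalgFreeProd φ ψ :=
  (amalgUniversal φ ψ).1.toComplHom

theorem AmalgFreeProd.norm_ofFree {L : Type*} [Semiring L] [Algebra ℂ L] [Star L]
    (φ : L →⋆ₐ[ℂ] A) (ψ : L →⋆ₐ[ℂ] B) (x : FreeStarAlg A B) :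
    ‖ofFree φ ψ x‖ = (amalgUniversal φ ψ).1 x :=
  (amalgUniversal φ ψ).1.norm_toCompl x

theorem AmalgFreeProd.denseRange_ofFree {L : Type*} [Semiring L] [Algebra ℂ L] [Star L]
    (φ : L →⋆ₐ[ℂ] A) (ψ : L →⋆ₐ[ℂ] B) : DenseRange (ofFree φ ψ) :=
  UniformSpace.Completion.denseRange_coe (α := (amalgUniversal φ ψ).1.Dom)

/-- The amalgamated free product over `D` is a quotient of the one over a subalgebra, and hence
separable if the latter is. -/
theorem AmalgFreeProd.separableSpace_of_subalgebra (φ : D →⋆ₐ[ℂ] A) (ψ : D →⋆ₐ[ℂ] B)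
    (L : StarSubalgebra ℂ D)
    [TopologicalSpace.SeparableSpace (AmalgFreeProd (φ.comp L.subtype) (ψ.comp L.subtype))] :
    TopologicalSpace.SeparableSpace (AmalgFreeProd φ ψ) := by
  obtain ⟨π, hπ⟩ : ∃ π : AmalgFreeProd (φ.comp L.subtype) (ψ.comp L.subtype) →⋆ₐ[ℂ]
      AmalgFreeProd φ ψ, ∀ x, π (ofFree _ _ x) = ofFree φ ψ x :=
    CStarSeminorm.exists_extension _ (ofFree φ ψ) fun x =>
      (norm_ofFree φ ψ x).le.trans (((amalgUniversal φ ψ).restrictTop L).le_iSup x)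
  have hd : DenseRange π := (denseRange_ofFree φ ψ).mono <| by
    rintro _ ⟨x, rfl⟩
    exact ⟨_, hπ x⟩
  have hc : Continuous π := AddMonoidHomClass.continuous_of_bound π 1 fun x => by
    rw [one_mul]
    exact NonUnitalStarAlgHom.norm_apply_le π x
  exact hd.separableSpace hc

end Amalg

theorem mainTheorem6 {A B D : Type*} [CStarAlgebra A] [CStarAlgebra B] [CStarAlgebra D]
    [TopologicalSpace.SeparableSpace A] [TopologicalSpace.SeparableSpace B]
    [TopologicalSpace.SeparableSpace D]
    (φ : D →⋆ₐ[ℂ] A) (ψ : D →⋆ₐ[ℂ] B)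
    (hφ : Function.Injective φ) (hψ : Function.Injective ψ)
    (Dk : ℕ → StarSubalgebra ℂ D) (hclosed : ∀ k, IsClosed (Dk k : Set D))
    (hmono : Monotone Dk) (hdense : Dense (⋃ k, (Dk k : Set D)))
    (hMF : ∀ k, IsMF (AmalgFreeProd (φ.comp (Dk k).subtype) (ψ.comp (Dk k).subtype))) :
    IsMF (AmalgFreeProd φ ψ) := by
  have := (hMF 0).1
  have := AmalgFreeProd.separableSpace_of_subalgebra φ ψ (Dk 0)
  refine isMF_of_tendsto_norm (AmalgFreeProd.ofFree φ ψ) (AmalgFreeProd.denseRange_ofFree φ ψ) hMF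
    (fun k => AmalgFreeProd.ofFree (φ.comp (Dk k).subtype) (ψ.comp (Dk k).subtype)) fun x => ?_
  simp only [AmalgFreeProd.norm_ofFree]
  exact tendsto_amalgUniversal φ ψ hmono hdense x
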